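/- Let $\mathrm{C}(x)$ denote the plain Kolmogorov complexity of a binary string $x$: the minimal length of a program that generates $x$ in a fixed optimal programming language. (A programming language is a partial computable map $U$ from binary strings to binary strings; it is optimal if for every partial computable $V$ there is a constant $c$ such that $\mathrm{C}_U(x)\le \mathrm{C}_V(x)+c$ for all $x$, where $\mathrm{C}_U(x)=\min\{|p| : U(p)=x\}$ and $\min\emptyset=\infty$. The result holds for every choice of the optimal language.) Let $X=x_1x_2x_3\ldots$ be an infinite bit sequence whose effective Hausdorff dimension $$\liminf_{n\to\infty}\frac{\mathrm{C}(x_1\ldots x_n)}{n}$$ is at least $\gamma$, for some real $\gamma<1$. Let $(\delta_n)_{n\ge 1}$ be a sequence of positive reals with $\lim_{n\to\infty}\delta_n=0$. Then there exists an infinite bit sequence $X'=x'_1x'_2x'_3\ldots$ such that: 1. the Besicovitch distance between $X$ and $X'$ is $0$, that is, $$\limsup_{n\to\infty}\frac{\#\{i\le n : x_i\ne x'_i\}}{n}=0;$$ 2. $\mathrm{C}(x'_1\ldots x'_n)\ge n(\gamma+\delta_n)$ for all sufficiently large $n$. -/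

import Mathlib

open Filter Topology

/-- The (plain) Kolmogorov complexity of the binary string `x` with respect to the programming
language `U`: the minimal length of a program that generates `x`. -/
noncomputable def plainComplexity (U : List Bool →. List Bool) (x : List Bool) : ℕ :=
  sInf {k : ℕ | ∃ p : List Bool, x ∈ U p ∧ p.length = k}

/-- `U` is an optimal programming language: it is partial computable, and for every partial
computable `V` there is a constant `c` such that whatever `V` generates from a program `p`, `U`
generates from some program of length at most `p.length + c`. In particular every string has a
program for `U` (see `IsOptimalLanguage.exists_program`). -/
def IsOptimalLanguage (U : List Bool →. List Bool) : Prop :=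
  Partrec U ∧ ∀ V : List Bool →. List Bool, Partrec V →
    ∃ c : ℕ, ∀ p x : List Bool, x ∈ V p → ∃ q : List Bool, x ∈ U q ∧ q.length ≤ p.length + c

/-- The minimum in `plainComplexity` is taken over a nonempty set when `U` is optimal. -/
theorem IsOptimalLanguage.exists_program {U : List Bool →. List Bool} (hU : IsOptimalLanguage U)
    (x : List Bool) : ∃ p : List Bool, x ∈ U p := by
  obtain ⟨c, hc⟩ := hU.2 (fun p => Part.some p) Partrec.some
  obtain ⟨q, hq, -⟩ := hc x x (Part.mem_some x)
  exact ⟨q, hq⟩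

/-- Splits `1ᵏ0q` into `k` and `q`. -/
def splitUnary (p : List Bool) : Option (ℕ × List Bool) :=
  List.rec (motive := fun _ => Option (ℕ × List Bool)) none
    (fun b l r => bif b then r.map (fun s => (s.1 + 1, s.2)) else some (0, l)) p

theorem splitUnary_replicate (k : ℕ) (q : List Bool) :
    splitUnary (List.replicate k true ++ false :: q) = some (k, q) := by
  induction k with
  | zero => rfl
  | succ k ih =>
    have h : splitUnary (true :: (List.replicate k true ++ false :: q)) =
      (splitUnary (List.replicate k true ++ false :: q)).map (fun s => (s.1 + 1, s.2)) := rfl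
    rw [List.replicate_succ, List.cons_append, h, ih]
    rfl

theorem primrec_splitUnary : Primrec splitUnary := by
  unfold splitUnary
  refine Primrec.list_rec (f := fun p : List Bool => p)
    (g := fun _ => (none : Option (ℕ × List Bool)))
    (h := fun (_ : List Bool) (t : Bool × List Bool × Option (ℕ × List Bool)) =>
      bif t.1 then t.2.2.map (fun s => (s.1 + 1, s.2)) else some (0, t.2.1))
    Primrec.id (Primrec.const none) ?_
  refine Primrec.cond (Primrec.fst.comp Primrec.snd) ?_ ?_
  · refine Primrec.option_map (Primrec.snd.comp (Primrec.snd.comp Primrec.snd)) ?_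
    exact Primrec.pair (Primrec.succ.comp (Primrec.fst.comp Primrec.snd))
      (Primrec.snd.comp Primrec.snd)
  · exact Primrec.option_some.comp (Primrec.pair (Primrec.const 0)
      (Primrec.fst.comp (Primrec.snd.comp Primrec.snd)))

/-- Optimal programming languages exist. -/
theorem exists_isOptimalLanguage : ∃ U : List Bool →. List Bool, IsOptimalLanguage U := by
  refine ⟨fun p => (splitUnary p : Part (ℕ × List Bool)).bind fun s =>
    ((Denumerable.ofNat Nat.Partrec.Code s.1).eval (Encodable.encode s.2)).bind fun m =>
      (Encodable.decode (α := List Bool) m : Part (List Bool)), ?_, ?_⟩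
  · refine Partrec.bind (Computable.ofOption primrec_splitUnary.to_comp) ?_
    refine Partrec.bind ?_ ?_
    · exact Nat.Partrec.Code.eval_part.comp
        ((Computable.ofNat _).comp (Computable.fst.comp Computable.snd))
        (Computable.encode.comp (Computable.snd.comp Computable.snd))
    · exact Computable.ofOption (Computable.decode.comp Computable.snd)
  · intro V hV
    obtain ⟨C, hC⟩ := Nat.Partrec.Code.exists_code.1 hV
    refine ⟨Encodable.encode C + 1, fun p x hx =>
      ⟨List.replicate (Encodable.encode C) true ++ false :: p, ?_, ?_⟩⟩
    · simp only [splitUnary_replicate, Part.coe_some, Part.bind_some, Denumerable.ofNat_encode, hC,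
        Encodable.encodek, Part.mem_bind_iff, Part.mem_map_iff]
      exact ⟨_, ⟨x, hx, rfl⟩, by simp⟩
    · simp; omega

/-- The string of the first `n` bits `x₁ … xₙ` of the sequence `X`, where `xᵢ₊₁ = X i`. -/
def bitPrefix (X : ℕ → Bool) (n : ℕ) : List Bool :=
  List.ofFn fun i : Fin n => X i

/-- The effective Hausdorff dimension of `X`, computed with the programming language `U`; the
lower limit is taken in the extended reals, where it always exists. -/
noncomputable def effectiveDim (U : List Bool →. List Bool) (X : ℕ → Bool) : EReal :=
  liminf (fun n : ℕ => (((plainComplexity U (bitPrefix X n) : ℝ) / (n : ℝ) : ℝ) : EReal)) atTop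

/-- The Besicovitch distance between two bit sequences: the upper limit of the fraction of
different bits in the prefixes of length `n`. (All these fractions lie in `[0, 1]`.) -/
noncomputable def besicovitchDist (X Y : ℕ → Bool) : ℝ :=
  limsup (fun n : ℕ =>
    (hammingDist (fun i : Fin n => X i) (fun i : Fin n => Y i) : ℝ) / (n : ℝ)) atTop

/-! `X'` is a random perturbation of `X`: bit `i` is flipped independently with probability `1 / (K
i + 1)`, where `K` tends to infinity slowly. The flipping probabilities tend to 0, so almost surely
the distance is 0 (`ae_noisyLaw_tendsto_hammingDist`).

For complexity, let `A` be the strings of length `n` and complexity below `m ≈ n(γ + δ n)`, so `|A|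
≤ 2 ^ m`, and let `B` be the strings that the noise moves into `A` with probability above `1 / (n +
1) ^ 2`. With `τ = 1 / (K n + 1)`, hypercontractivity gives small-set expansion (`logb_card_le`):
`(1 - τ) log |B| ≤ m - τ n + O(log n)`. Since `B` is enumerable from `n`, `m` and a code of the
noise, its members have complexity at most `log |B| + O(log n)`
(`IsOptimalLanguage.exists_complexity_le_of_nearSimple`).

If the prefix of `X` were in `B`, its complexity, at least `n(γ - o(1))`, would force `τ(1 - γ)`
below a fixed null sequence. As `γ < 1`, a slow enough `K` with `O(log n)`-bit codes excludes this
(`exists_noise_schedule`). So for large `n` the noise reaches `A` with probability at most `1 / (n +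
1) ^ 2`, and Borel–Cantelli finishes. Negative `γ` is replaced by 0. -/

/-! ### Complexity of the members of enumerable finite sets. -/

/-- The natural number with the given binary digits, the least significant digit first. -/
def bitsValue (l : List Bool) : ℕ :=
  l.foldr (fun b n => bif b then 2 * n + 1 else 2 * n) 0

theorem bitsValue_bits (n : ℕ) : bitsValue n.bits = n := by
  induction n using Nat.binaryRec' with
  | zero => simp [bitsValue]
  | bit b n h ih =>
    rw [Nat.bits_append_bit n b h]
    cases b <;> simp_all [bitsValue, Nat.bit_val]

theorem primrec_bitsValue : Primrec bitsValue := by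
  unfold bitsValue
  refine Primrec.list_foldr (f := fun l : List Bool => l) (g := fun _ => 0)
    (h := fun _ (s : Bool × ℕ) => bif s.1 then 2 * s.2 + 1 else 2 * s.2)
    Primrec.id (Primrec.const 0) ?_
  have h2 : Primrec fun q : List Bool × Bool × ℕ => 2 * q.2.2 :=
    Primrec.nat_mul.comp (Primrec.const 2) (Primrec.snd.comp Primrec.snd)
  exact Primrec.cond (Primrec.fst.comp Primrec.snd) (Primrec.succ.comp h2) h2

/-- One step of the enumeration without repetitions of `{x | ∃ u, P a x u}`. -/
def enumStep (P : ℕ → List Bool → ℕ → Bool) (a t : ℕ) (l : List (List Bool)) :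
    List (List Bool) :=
  Option.casesOn (Encodable.decode (α := List Bool × ℕ) t) l
    fun q => bif P a q.1 q.2 && decide (l.length ≤ l.idxOf q.1) then l ++ [q.1] else l

/-- The part of `{x | ∃ u, P a x u}` enumerated in `t` steps. -/
def enumList (P : ℕ → List Bool → ℕ → Bool) (a t : ℕ) : List (List Bool) :=
  Nat.rec [] (fun t l => enumStep P a t l) t

section Enumeration

variable {P : ℕ → List Bool → ℕ → Bool}

theorem primrec_enumList (hP : Primrec fun q : ℕ × List Bool × ℕ => P q.1 q.2.1 q.2.2) :
    Primrec₂ (enumList P) := by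
  unfold enumList
  refine Primrec.nat_rec' (f := fun q : ℕ × ℕ => q.2) (g := fun _ => [])
    (h := fun q (s : ℕ × List (List Bool)) => enumStep P q.1 s.1 s.2)
    Primrec.snd (Primrec.const []) ?_
  unfold enumStep
  refine Primrec.option_casesOn
    (o := fun q : (ℕ × ℕ) × ℕ × List (List Bool) =>
      Encodable.decode (α := List Bool × ℕ) q.2.1)
    (f := fun q => q.2.2)
    (g := fun q r => bif P q.1.1 r.1 r.2 && decide (q.2.2.length ≤ q.2.2.idxOf r.1)
      then q.2.2 ++ [r.1] else q.2.2)
    (Primrec.decode.comp (Primrec.fst.comp Primrec.snd)) (Primrec.snd.comp Primrec.snd) ?_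
  have hl : Primrec fun q : ((ℕ × ℕ) × ℕ × List (List Bool)) × List Bool × ℕ => q.1.2.2 :=
    Primrec.snd.comp (Primrec.snd.comp Primrec.fst)
  have hx : Primrec fun q : ((ℕ × ℕ) × ℕ × List (List Bool)) × List Bool × ℕ => q.2.1 :=
    Primrec.fst.comp Primrec.snd
  refine Primrec.cond (Primrec.and.comp ?_ ?_) (Primrec.list_concat.comp hl hx) hl
  · exact hP.comp (Primrec.pair (Primrec.fst.comp (Primrec.fst.comp Primrec.fst)) Primrec.snd)
  · exact Primrec.nat_le.decide.comp (Primrec.list_length.comp hl)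
      (by convert Primrec.list_idxOf.comp hx hl)

theorem enumList_succ (a t : ℕ) : enumList P a (t + 1) = enumStep P a t (enumList P a t) := rfl

theorem enumStep_eq_or (a t : ℕ) (l : List (List Bool)) :
    enumStep P a t l = l ∨ ∃ x u, P a x u = true ∧ x ∉ l ∧ enumStep P a t l = l ++ [x] := by
  unfold enumStep
  rcases Encodable.decode (α := List Bool × ℕ) t with _ | ⟨x, u⟩
  · exact Or.inl rfl
  -- `idxOf` returns the length on absent elements, so the second condition is non-membership.
  · by_cases h : P a x u = true ∧ l.length ≤ l.idxOf x
    · refine Or.inr ⟨x, u, h.1, ?_, by simp [h]⟩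
      rw [← List.idxOf_lt_length_iff]
      omega
    · refine Or.inl ?_
      have : (P a x u && decide (l.length ≤ l.idxOf x)) = false := by
        rw [Bool.eq_false_iff]
        simpa using h
      simp [this]

theorem enumList_prefix_succ (a t : ℕ) : enumList P a t <+: enumList P a (t + 1) := by
  rw [enumList_succ]
  rcases enumStep_eq_or (P := P) a t (enumList P a t) with h | ⟨x, u, -, -, h⟩ <;> rw [h]
  exact List.prefix_append _ _

theorem enumList_prefix (a : ℕ) {s t : ℕ} (h : s ≤ t) : enumList P a s <+: enumList P a t := by
  induction h with
  | refl => exact List.prefix_rfl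
  | step _ ih => exact ih.trans (enumList_prefix_succ a _)

theorem enumList_nodup (a t : ℕ) : (enumList P a t).Nodup := by
  induction t with
  | zero => exact List.nodup_nil
  | succ t ih =>
    rw [enumList_succ]
    rcases enumStep_eq_or (P := P) a t (enumList P a t) with h | ⟨x, u, -, hx, h⟩ <;> rw [h]
    · exact ih
    · simpa [List.nodup_append, ih] using fun y hy h => hx (by rwa [← h])

theorem exists_of_mem_enumList {a t : ℕ} {x : List Bool} (hx : x ∈ enumList P a t) :
    ∃ u, P a x u = true := by
  induction t with
  | zero => simp [enumList] at hx
  | succ t ih =>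
    rw [enumList_succ] at hx
    rcases enumStep_eq_or (P := P) a t (enumList P a t) with h | ⟨y, u, hy, -, h⟩ <;> rw [h] at hx
    · exact ih hx
    · rcases List.mem_append.1 hx with hx | hx
      · exact ih hx
      · rw [List.mem_singleton.1 hx]
        exact ⟨u, hy⟩

theorem exists_mem_enumList {a u : ℕ} {x : List Bool} (hx : P a x u = true) :
    ∃ t, x ∈ enumList P a t := by
  refine ⟨Encodable.encode (x, u) + 1, ?_⟩
  rw [enumList_succ]
  unfold enumStep
  rw [Encodable.encodek]
  set l := enumList P a (Encodable.encode (x, u))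
  by_cases h : l.length ≤ l.idxOf x
  · simp [hx, h]
  · have : x ∈ l := List.idxOf_lt_length_iff.1 (not_le.1 h)
    simp [h, this]

/-- If a finite set contains the set enumerated from the number `a`, then the enumerated elements
have complexity at most the binary logarithm of its size, up to a self-delimiting description of
`a`. -/
theorem IsOptimalLanguage.exists_complexity_le_of_enumerable {U : List Bool →. List Bool}
    (hU : IsOptimalLanguage U) (hP : Primrec fun q : ℕ × List Bool × ℕ => P q.1 q.2.1 q.2.2) :
    ∃ c : ℕ, ∀ (a : ℕ) (S : Finset (List Bool)), (∀ x u, P a x u = true → x ∈ S) →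
      ∀ x u, P a x u = true → plainComplexity U x ≤ S.card.size + 2 * a.size + c := by
  -- The program `1^|a| 0 a i` names the `i`-th enumerated element: `a` is self-delimiting at cost
  -- `2 * a.size + 1`, and `i` takes the rest.
  let V : List Bool →. List Bool := fun p =>
    (splitUnary p : Part (ℕ × List Bool)).bind fun s =>
      Nat.rfindOpt fun t =>
        (enumList P (bitsValue (s.2.take s.1)) t)[bitsValue (s.2.drop s.1)]?
  have hV : Partrec V := by
    refine Partrec.bind (Computable.ofOption primrec_splitUnary.to_comp) ?_
    refine Partrec.rfindOpt (Primrec₂.to_comp ?_)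
    have h1 : Primrec fun q : (List Bool × ℕ × List Bool) × ℕ => q.1.2.1 :=
      Primrec.fst.comp (Primrec.snd.comp Primrec.fst)
    have h2 : Primrec fun q : (List Bool × ℕ × List Bool) × ℕ => q.1.2.2 :=
      Primrec.snd.comp (Primrec.snd.comp Primrec.fst)
    exact Primrec.list_getElem?.comp
      ((primrec_enumList hP).comp
        (primrec_bitsValue.comp (Primrec.list_take.comp h1 h2)) Primrec.snd)
      (primrec_bitsValue.comp (Primrec.list_drop.comp h1 h2))
  obtain ⟨c, hc⟩ := hU.2 V hV
  refine ⟨c + 1, fun a S hS x u hx => ?_⟩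
  obtain ⟨t, ht⟩ := exists_mem_enumList hx
  obtain ⟨i, hi, hix⟩ := List.getElem_of_mem ht
  have hcard : (enumList P a t).length ≤ S.card := by
    rw [← List.toFinset_card_of_nodup (enumList_nodup a t)]
    refine Finset.card_le_card fun y hy => ?_
    obtain ⟨v, hv⟩ := exists_of_mem_enumList (List.mem_toFinset.1 hy)
    exact hS y v hv
  have hVx : x ∈ V (List.replicate a.size true ++ false :: (a.bits ++ i.bits)) := by
    simp only [V, splitUnary_replicate, Part.coe_some, Part.bind_some]
    rw [List.take_left' (Nat.size_eq_bits_len a), List.drop_left' (Nat.size_eq_bits_len a),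
      bitsValue_bits, bitsValue_bits]
    -- The lists grow only at the end, so the entry at an index never changes and the search may
    -- stop at any stage that has one.
    refine (Nat.rfindOpt_mono ?_).2 ⟨t, ?_⟩
    · intro y m n hmn hy
      obtain ⟨l, hl⟩ := enumList_prefix (P := P) a hmn
      obtain ⟨hj, hy⟩ := List.getElem?_eq_some_iff.1 hy
      rw [← hl, List.getElem?_append_left hj, Option.mem_def, List.getElem?_eq_some_iff]
      exact ⟨hj, hy⟩
    · simp [List.getElem?_eq_getElem hi, hix]
  obtain ⟨q, hq, hql⟩ := hc _ x hVx
  have h1 : plainComplexity U x ≤ q.length := Nat.sInf_le ⟨q, hq, rfl⟩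
  have h2 : i.size ≤ S.card.size := Nat.size_le_size (by omega)
  simp only [List.length_append, List.length_replicate, List.length_cons,
    Nat.size_eq_bits_len] at hql
  omega

end Enumeration

/-! ### Hypercontractivity and small-set expansion. -/

/-- For `v > 0`, `v ^ (-s) = exp (-s log v) ≥ 1 - s log v ≥ 1 - s (v - 1)`. -/
theorem sq_mul_le_rpow {v s : ℝ} (hv : 0 ≤ v) (hs : 0 ≤ s) :
    v ^ 2 * (1 - s * (v - 1)) ≤ v ^ (2 - s) := by
  rcases hv.eq_or_lt with rfl | hv
  · simpa using Real.rpow_nonneg le_rfl _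
  · rw [sub_eq_add_neg (2 : ℝ) s, Real.rpow_add hv, Real.rpow_two]
    refine mul_le_mul_of_nonneg_left ?_ (sq_nonneg v)
    rw [Real.rpow_def_of_pos hv]
    have h1 := Real.add_one_le_exp (Real.log v * -s)
    have h2 := mul_le_mul_of_nonneg_left (Real.log_le_sub_one_of_pos hv) hs
    linarith

/-- The previous bounds at `1 + a` and `1 - a` average to `1 + (1 - 2 * s) * a ^ 2`, and Bernoulli's
inequality linearizes the left side. The sharp condition would be `c ≤ 1 - s`; the loss affects only
constants. -/
theorem one_add_sq_rpow_le {a s c : ℝ} (ha : -1 ≤ a) (ha' : a ≤ 1) (hs : 0 ≤ s)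
    (hs' : s ≤ 1 / 2) (hc : 0 ≤ c) (hcs : c ≤ 1 - 2 * s) :
    (1 + c * a ^ 2) ^ ((2 - s) / 2) ≤ ((1 + a) ^ (2 - s) + (1 - a) ^ (2 - s)) / 2 := by
  have h1 := sq_mul_le_rpow (v := 1 + a) (by linarith) hs
  have h2 := sq_mul_le_rpow (v := 1 - a) (by linarith) hs
  have h3 : (1 + c * a ^ 2) ^ ((2 - s) / 2) ≤ 1 + (2 - s) / 2 * (c * a ^ 2) :=
    rpow_one_add_le_one_add_mul_self (by nlinarith [mul_nonneg hc (sq_nonneg a)])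
      (by linarith) (by linarith)
  have h4 : (2 - s) / 2 * c ≤ 1 - 2 * s := by nlinarith
  nlinarith [mul_le_mul_of_nonneg_right h4 (sq_nonneg a)]

/-- By homogeneity, division by the mean of `u` and `v` reduces this to the previous lemma. -/
theorem two_point_rpow_le {u v s c : ℝ} (hu : 0 ≤ u) (hv : 0 ≤ v) (hs : 0 ≤ s)
    (hs' : s ≤ 1 / 2) (hc : 0 ≤ c) (hcs : c ≤ 1 - 2 * s) :
    (((u + v) / 2) ^ 2 + c * ((u - v) / 2) ^ 2) ^ ((2 - s) / 2) ≤
      (u ^ (2 - s) + v ^ (2 - s)) / 2 := by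
  set F := (u + v) / 2 with hF
  rcases (show 0 ≤ F by positivity).eq_or_lt with h | h
  · have hu0 : u = 0 := by linarith
    have hv0 : v = 0 := by linarith
    rw [← h, hu0, hv0]
    simp [Real.zero_rpow (show (2 - s) / 2 ≠ 0 by linarith),
      Real.zero_rpow (show 2 - s ≠ 0 by linarith)]
  · set a := (u - v) / 2 / F with ha
    have hFa : F * a = (u - v) / 2 := by rw [ha]; field_simp
    have hu' : u = F * (1 + a) := by linarith
    have hv' : v = F * (1 - a) := by linarith
    have ha1 : 0 ≤ 1 + a := by
      by_contra hn
      nlinarith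
    have ha2 : 0 ≤ 1 - a := by
      by_contra hn
      nlinarith
    have key := one_add_sq_rpow_le (a := a) (by linarith) (by linarith) hs hs' hc hcs
    have hF2 : (F ^ 2) ^ ((2 - s) / 2) = F ^ (2 - s) := by
      rw [← Real.rpow_natCast, ← Real.rpow_mul h.le]
      congr 1
      push_cast
      ring
    rw [← hFa, show F ^ 2 + c * (F * a) ^ 2 = F ^ 2 * (1 + c * a ^ 2) by ring,
      Real.mul_rpow (by positivity) (by positivity), hF2, hu', hv',
      Real.mul_rpow h.le ha1, Real.mul_rpow h.le ha2]
    nlinarith [mul_le_mul_of_nonneg_left key (Real.rpow_nonneg h.le (2 - s))]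

/-- The unnormalized `ℓʳ` norm of a nonnegative function on a finite type. -/
noncomputable def sumNorm {ι : Type*} [Fintype ι] (r : ℝ) (f : ι → ℝ) : ℝ :=
  (∑ i, f i ^ r) ^ r⁻¹

theorem sumNorm_nonneg {ι : Type*} [Fintype ι] {r : ℝ} {f : ι → ℝ} (hf : ∀ i, 0 ≤ f i) :
    0 ≤ sumNorm r f :=
  Real.rpow_nonneg (Finset.sum_nonneg fun i _ => Real.rpow_nonneg (hf i) r) _

theorem sumNorm_rpow {ι : Type*} [Fintype ι] {r : ℝ} (hr : r ≠ 0) {f : ι → ℝ}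
    (hf : ∀ i, 0 ≤ f i) : sumNorm r f ^ r = ∑ i, f i ^ r :=
  Real.rpow_inv_rpow (Finset.sum_nonneg fun i _ => Real.rpow_nonneg (hf i) r) hr

/-- The probability that the bit `a` is turned into `b` by flipping it with probability
`1 / (k + 1)`. -/
noncomputable def flipWeight (k : ℝ) (a b : Bool) : ℝ :=
  (if a = b then k else 1) / (k + 1)

theorem flipWeight_nonneg {k : ℝ} (hk : 0 ≤ k) (a b : Bool) : 0 ≤ flipWeight k a b := by
  unfold flipWeight
  split_ifs <;> positivity

/-- Bonami's two-point inequality: on the left is the `L²` norm of `f` after its mean-zero part is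
damped by `√c`. The power of `2⁻¹` normalizes the counting measure. -/
theorem sqrt_le_sumNorm {f : Bool → ℝ} (hf : ∀ b, 0 ≤ f b) {s c : ℝ} (hs : 0 ≤ s)
    (hs' : s ≤ 1 / 2) (hc : 0 ≤ c) (hcs : c ≤ 1 - 2 * s) :
    √(((f true + f false) / 2) ^ 2 + c * ((f true - f false) / 2) ^ 2) ≤
      2⁻¹ ^ (2 - s)⁻¹ * sumNorm (2 - s) f := by
  have h := two_point_rpow_le (hf true) (hf false) hs hs' hc hcs
  have hr : 0 < 2 - s := by linarith
  set q := ((f true + f false) / 2) ^ 2 + c * ((f true - f false) / 2) ^ 2 with hq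
  have hq0 : 0 ≤ q := by positivity
  have h' := Real.rpow_le_rpow (by positivity) h (inv_nonneg.2 hr.le)
  rw [← Real.rpow_mul hq0, show (2 - s) / 2 * (2 - s)⁻¹ = 1 / 2 by field_simp,
    ← Real.sqrt_eq_rpow] at h'
  refine h'.trans_eq ?_
  rw [sumNorm, Fintype.sum_bool, ← Real.mul_rpow (by norm_num)
    (add_nonneg (Real.rpow_nonneg (hf _) _) (Real.rpow_nonneg (hf _) _)), div_eq_inv_mul]

/-- The channel multiplies mean-zero functions by `c = 1 - 2 / (k + 1)`. Cauchy–Schwarz gives each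
function a factor `√c`, and the two-point inequality applies to both. The leading 2 is there because
the sum over `a` is not averaged. -/
theorem two_point_hypercontractivity {f g : Bool → ℝ} (hf : ∀ b, 0 ≤ f b) (hg : ∀ b, 0 ≤ g b)
    {k s : ℝ} (hk : 1 ≤ k) (hs : 0 ≤ s) (hs' : s ≤ 1 / (k + 1)) :
    ∑ a, ∑ b, flipWeight k a b * (f a * g b) ≤
      2 * 2⁻¹ ^ (2 - s)⁻¹ * 2⁻¹ ^ (2 - s)⁻¹ * (sumNorm (2 - s) f * sumNorm (2 - s) g) := by
  have hk1 : 0 < k + 1 := by linarith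
  have hs2 : s ≤ 1 / 2 := hs'.trans (by gcongr; linarith)
  set c := 1 - 2 * (1 / (k + 1)) with hc
  have hc0 : 0 ≤ c := by
    have : 1 / (k + 1) ≤ 1 / 2 := by gcongr; linarith
    linarith
  have hcs : c ≤ 1 - 2 * s := by linarith
  have Hf := sqrt_le_sumNorm hf hs hs2 hc0 hcs
  have Hg := sqrt_le_sumNorm hg hs hs2 hc0 hcs
  set F := (f true + f false) / 2 with hF
  set D := (f true - f false) / 2 with hD
  set G := (g true + g false) / 2 with hG
  set E := (g true - g false) / 2 with hE
  have hsum : ∑ a, ∑ b, flipWeight k a b * (f a * g b) = 2 * (F * G + c * (D * E)) := by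
    simp only [Fintype.sum_bool, flipWeight, hF, hD, hG, hE, hc]
    simp
    field_simp
    ring
  have hcs2 : F * G + c * (D * E) ≤ √(F ^ 2 + c * D ^ 2) * √(G ^ 2 + c * E ^ 2) := by
    rw [← Real.sqrt_mul (by positivity)]
    refine Real.le_sqrt_of_sq_le ?_
    nlinarith [mul_nonneg hc0 (sq_nonneg (F * E - D * G))]
  rw [hsum]
  have := mul_le_mul Hf Hg (Real.sqrt_nonneg _) ((Real.sqrt_nonneg _).trans Hf)
  calc 2 * (F * G + c * (D * E)) ≤ 2 * (2⁻¹ ^ (2 - s)⁻¹ * sumNorm (2 - s) f *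
        (2⁻¹ ^ (2 - s)⁻¹ * sumNorm (2 - s) g)) := by linarith
    _ = _ := by ring

theorem sum_fin_succ_bool {n : ℕ} (F : (Fin (n + 1) → Bool) → ℝ) :
    ∑ x, F x = ∑ b : Bool, ∑ x : Fin n → Bool, F (Fin.cons b x) := by
  rw [← Fintype.sum_prod_type']
  exact (Fintype.sum_equiv (Fin.consEquiv fun _ => Bool) _ _ fun _ => rfl).symm

/-- The two-function form of hypercontractivity for the product of bit-flipping channels. -/
theorem hypercontractivity {s : ℝ} (hs : 0 ≤ s) (n : ℕ) (k : Fin n → ℝ) (hk : ∀ i, 1 ≤ k i)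
    (hs' : ∀ i, s ≤ 1 / (k i + 1)) (hs2 : s ≤ 1 / 2) (f g : (Fin n → Bool) → ℝ)
    (hf : ∀ x, 0 ≤ f x) (hg : ∀ x, 0 ≤ g x) :
    ∑ x, ∑ y, (∏ i, flipWeight (k i) (x i) (y i)) * (f x * g y) ≤
      (2 * 2⁻¹ ^ (2 - s)⁻¹ * 2⁻¹ ^ (2 - s)⁻¹) ^ n *
        (sumNorm (2 - s) f * sumNorm (2 - s) g) := by
  have hr : 2 - s ≠ 0 := by linarith
  induction n with
  | zero =>
    simp only [sumNorm, Fintype.sum_unique]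
    rw [Real.rpow_rpow_inv (hf _) hr, Real.rpow_rpow_inv (hg _) hr]
    simp
  | succ n ih =>
    set C : ℝ := 2 * 2⁻¹ ^ (2 - s)⁻¹ * 2⁻¹ ^ (2 - s)⁻¹ with hC
    have hC0 : 0 ≤ C := by positivity
    -- The norm of the slice norms is the full norm; this lets the one-bit inequality, applied to
    -- slice norms, complete the induction.
    have hnorm : ∀ h : (Fin (n + 1) → Bool) → ℝ, (∀ x, 0 ≤ h x) →
        sumNorm (2 - s) (fun b : Bool => sumNorm (2 - s) fun x => h (Fin.cons b x)) =
          sumNorm (2 - s) h := by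
      intro h hh
      rw [sumNorm, sumNorm]
      congr 1
      rw [sum_fin_succ_bool]
      exact Finset.sum_congr rfl fun b _ => sumNorm_rpow hr fun x => hh _
    have hmul : ∀ (a b : Bool) (x y : Fin n → Bool),
        (∏ i, flipWeight (k i) (Fin.cons (α := fun _ => Bool) a x i)
          (Fin.cons (α := fun _ => Bool) b y i)) *
          (f (Fin.cons a x) * g (Fin.cons b y)) =
        flipWeight (k 0) a b * ((∏ i, flipWeight (k i.succ) (x i) (y i)) *
          (f (Fin.cons a x) * g (Fin.cons b y))) := by
      intro a b x y
      rw [Fin.prod_univ_succ]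
      simp [mul_assoc]
    calc ∑ x, ∑ y, (∏ i, flipWeight (k i) (x i) (y i)) * (f x * g y)
        = ∑ a, ∑ b, flipWeight (k 0) a b *
            ∑ x : Fin n → Bool, ∑ y : Fin n → Bool,
              (∏ i : Fin n, flipWeight (k i.succ) (x i) (y i)) *
                (f (Fin.cons a x) * g (Fin.cons b y)) := by
          simp only [sum_fin_succ_bool, hmul, Finset.mul_sum]
          refine Finset.sum_congr rfl fun a _ => ?_
          rw [Finset.sum_comm]
      _ ≤ ∑ a, ∑ b, flipWeight (k 0) a b * (C ^ n *
            (sumNorm (2 - s) (fun x : Fin n → Bool => f (Fin.cons a x)) *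
              sumNorm (2 - s) (fun x : Fin n → Bool => g (Fin.cons b x)))) := by
          refine Finset.sum_le_sum fun a _ => Finset.sum_le_sum fun b _ => ?_
          refine mul_le_mul_of_nonneg_left ?_
            (flipWeight_nonneg (zero_le_one.trans (hk 0)) a b)
          exact ih (fun i => k i.succ) (fun i => hk _) (fun i => hs' _) _ _
            (fun _ => hf _) (fun _ => hg _)
      _ = C ^ n * ∑ a, ∑ b, flipWeight (k 0) a b *
            (sumNorm (2 - s) (fun x : Fin n → Bool => f (Fin.cons a x)) *
              sumNorm (2 - s) (fun x : Fin n → Bool => g (Fin.cons b x))) := by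
          simp only [Finset.mul_sum]
          refine Finset.sum_congr rfl fun a _ => Finset.sum_congr rfl fun b _ => by ring
      _ ≤ C ^ n * (C * (sumNorm (2 - s) f * sumNorm (2 - s) g)) := by
          refine mul_le_mul_of_nonneg_left ?_ (pow_nonneg hC0 n)
          have := two_point_hypercontractivity
            (f := fun a : Bool => sumNorm (2 - s) fun x : Fin n → Bool => f (Fin.cons a x))
            (g := fun a : Bool => sumNorm (2 - s) fun x : Fin n → Bool => g (Fin.cons a x))
            (fun b => sumNorm_nonneg fun x => hf _)
            (fun b => sumNorm_nonneg fun x => hg _) (hk 0) hs (hs' 0)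
          rwa [hnorm f hf, hnorm g hg] at this
      _ = _ := by rw [pow_succ]; ring

/-- Small-set expansion: if from every point of `B` the channel hits `A` with probability more
than `2⁻ᵉ`, then `B` is small compared with `A`. -/
theorem logb_card_le {s : ℝ} (hs : 0 ≤ s) (n : ℕ) (k : Fin n → ℝ) (hk : ∀ i, 1 ≤ k i)
    (hs' : ∀ i, s ≤ 1 / (k i + 1)) (hs2 : s ≤ 1 / 2) (A B : Finset (Fin n → Bool))
    {e m : ℝ} (he : 0 ≤ e) (hA : (A.card : ℝ) ≤ 2 ^ m) (hB : B.Nonempty)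
    (hAB : ∀ x ∈ B, (2 : ℝ) ^ (-e) ≤ ∑ y ∈ A, ∏ i, flipWeight (k i) (x i) (y i)) :
    (1 - s) * Real.logb 2 B.card ≤ m - s * n + 2 * e := by
  classical
  have hr : 0 < 2 - s := by linarith
  have h := hypercontractivity hs n k hk hs' hs2 (fun x => if x ∈ B then 1 else 0)
    (fun y => if y ∈ A then 1 else 0) (fun x => by split_ifs <;> simp)
    (fun x => by split_ifs <;> simp)
  have hnorm : ∀ S : Finset (Fin n → Bool),
      sumNorm (2 - s) (fun x => if x ∈ S then (1 : ℝ) else 0) = (S.card : ℝ) ^ (2 - s)⁻¹ := by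
    intro S
    rw [sumNorm]
    congr 1
    simp [apply_ite (fun t : ℝ => t ^ (2 - s)), Real.zero_rpow hr.ne']
  rw [hnorm, hnorm] at h
  have hB0 : (0 : ℝ) < B.card := by exact_mod_cast hB.card_pos
  have hlow : (B.card : ℝ) * 2 ^ (-e) ≤ ∑ x : Fin n → Bool, ∑ y : Fin n → Bool,
      (∏ i, flipWeight (k i) (x i) (y i)) *
        ((if x ∈ B then 1 else 0) * (if y ∈ A then 1 else 0)) := by
    have : ∀ x : Fin n → Bool, ∑ y : Fin n → Bool, (∏ i, flipWeight (k i) (x i) (y i)) *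
        ((if x ∈ B then 1 else 0) * (if y ∈ A then 1 else 0)) =
        if x ∈ B then ∑ y ∈ A, ∏ i, flipWeight (k i) (x i) (y i) else 0 := by
      intro x
      split_ifs <;> simp [Finset.sum_ite_mem]
    simp only [this, Finset.sum_ite_mem, Finset.univ_inter]
    rw [← nsmul_eq_mul]
    exact Finset.card_nsmul_le_sum _ _ _ hAB
  have hmain := (hlow.trans h).trans (mul_le_mul_of_nonneg_left
    (mul_le_mul_of_nonneg_left (Real.rpow_le_rpow (Nat.cast_nonneg _) hA (inv_nonneg.2 hr.le))
      (Real.rpow_nonneg hB0.le _)) (by positivity))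
  have hlog := Real.logb_le_logb_of_le one_lt_two (by positivity) hmain
  have hC : (2 : ℝ) * 2⁻¹ ^ (2 - s)⁻¹ * 2⁻¹ ^ (2 - s)⁻¹ = 2 ^ (1 - 2 * (2 - s)⁻¹) := by
    rw [Real.inv_rpow (by norm_num), ← Real.rpow_neg (by norm_num), mul_assoc,
      ← Real.rpow_add two_pos]
    nth_rewrite 1 [← Real.rpow_one 2]
    rw [← Real.rpow_add two_pos]
    congr 1
    ring
  have hCn : (0 : ℝ) < (2 ^ (1 - 2 * (2 - s)⁻¹)) ^ n := by positivity
  rw [hC, Real.logb_mul hB0.ne' (by positivity), Real.logb_mul hCn.ne' (by positivity),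
    Real.logb_mul (by positivity) (by positivity), Real.logb_pow,
    Real.logb_rpow two_pos (by norm_num), Real.logb_rpow two_pos (by norm_num),
    Real.logb_rpow_eq_mul_logb_of_pos hB0, ← Real.rpow_mul two_pos.le,
    Real.logb_rpow two_pos (by norm_num)] at hlog
  -- This becomes `(2 - s)(log |B| - e) ≤ -s n + log |B| + m`, and `(2 - s) e ≤ 2 e`.
  have hmul := mul_le_mul_of_nonneg_left hlog hr.le
  have hinv : (2 - s) * (2 - s)⁻¹ = 1 := mul_inv_cancel₀ hr.ne'
  have : (2 - s) * (n * (1 - 2 * (2 - s)⁻¹) + ((2 - s)⁻¹ * Real.logb 2 B.card + m * (2 - s)⁻¹)) =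
      -(s * n) + Real.logb 2 B.card + m := by
    linear_combination (-2 * n + Real.logb 2 B.card + m) * hinv
  rw [this] at hmul
  nlinarith

/-! ### Enumerability of the strings close to simple ones. -/

theorem Primrec.sum_range {α : Type*} [Primcodable α] {f : α → ℕ → ℕ} {g : α → ℕ}
    (hf : Primrec₂ f) (hg : Primrec g) : Primrec fun a => ∑ i ∈ Finset.range (g a), f a i := by
  have h : Primrec₂ fun (a : α) (q : ℕ × ℕ) => q.2 + f a q.1 :=
    Primrec.nat_add.comp (Primrec.snd.comp Primrec.snd)
      (hf.comp Primrec.fst (Primrec.fst.comp Primrec.snd))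
  refine (Primrec.nat_rec' hg (Primrec.const 0) h).of_eq fun a => ?_
  induction g a with
  | zero => rfl
  | succ n ih => rw [Finset.sum_range_succ, ← ih]

theorem Primrec.prod_range {α : Type*} [Primcodable α] {f : α → ℕ → ℕ} {g : α → ℕ}
    (hf : Primrec₂ f) (hg : Primrec g) : Primrec fun a => ∏ i ∈ Finset.range (g a), f a i := by
  have h : Primrec₂ fun (a : α) (q : ℕ × ℕ) => q.2 * f a q.1 :=
    Primrec.nat_mul.comp (Primrec.snd.comp Primrec.snd)
      (hf.comp Primrec.fst (Primrec.fst.comp Primrec.snd))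
  refine (Primrec.nat_rec' hg (Primrec.const 1) h).of_eq fun a => ?_
  induction g a with
  | zero => rfl
  | succ n ih => rw [Finset.prod_range_succ, ← ih]

theorem primrec_two_pow : Primrec fun n : ℕ => 2 ^ n :=
  (Primrec.prod_range (f := fun _ _ => 2) (Primrec.const 2).to₂ Primrec.id).of_eq fun n => by simp

/-- The `j`-th binary digit of `s`. -/
def binaryDigit (s j : ℕ) : ℕ := s / 2 ^ j % 2

theorem primrec_binaryDigit : Primrec₂ binaryDigit :=
  Primrec.nat_mod.comp
    (Primrec.nat_div.comp Primrec.fst (primrec_two_pow.comp Primrec.snd)) (Primrec.const 2)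

/-- The parameter `k` of the noise at position `i` (which flips the bit with probability
`1 / (k + 1)`), when `s` encodes the scales `2 ^ j` at which the noise decreases. -/
def noiseLevel (s i : ℕ) : ℕ :=
  1 + ∑ j ∈ Finset.range i, if 2 ^ j ≤ i then binaryDigit s j else 0

theorem primrec_noiseLevel : Primrec₂ noiseLevel := by
  refine Primrec.nat_add.comp (Primrec.const 1) (Primrec.sum_range ?_ Primrec.snd)
  refine Primrec.ite (Primrec.nat_le.comp (primrec_two_pow.comp Primrec.snd)
    (Primrec.snd.comp Primrec.fst)) ?_ (Primrec.const 0)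
  exact primrec_binaryDigit.comp (Primrec.fst.comp Primrec.fst) Primrec.snd

/-- The string of the first `n` binary digits of `j`. -/
def digitString (n j : ℕ) : List Bool :=
  (List.range n).map fun i => decide (binaryDigit j i = 1)

theorem primrec_digitString : Primrec₂ digitString :=
  Primrec.list_map (Primrec.list_range.comp Primrec.fst)
    (Primrec.eq.decide.comp
      (primrec_binaryDigit.comp (Primrec.snd.comp Primrec.fst) Primrec.snd) (Primrec.const 1))

/-- Makes sums over the cube primitive recursive, as sums over a range of numbers. -/
theorem sum_digitString {M : Type*} [AddCommMonoid M] (n : ℕ) (F : List Bool → M) :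
    ∑ j ∈ Finset.range (2 ^ n), F (digitString n j) = ∑ y : Fin n → Bool, F (List.ofFn y) := by
  rw [Finset.sum_range]
  refine Fintype.sum_equiv
    (finFunctionFinEquiv.symm.trans (Equiv.arrowCongr (Equiv.refl _) finTwoEquiv)) _ _ fun j => ?_
  congr 1
  refine List.ext_getElem (by simp [digitString]) fun i h1 h2 => ?_
  have key : ∀ t : Fin 2, decide ((t : ℕ) = 1) = finTwoEquiv t := by decide
  simpa [digitString, binaryDigit] using key (finFunctionFinEquiv.symm j ⟨i, by simpa using h2⟩)

/-- Whether `u` encodes a program of length less than `m` and a number of steps in which the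
interpreter `C` generates `y` from the program. -/
def hits (C : Nat.Partrec.Code) (m : ℕ) (y : List Bool) (u : ℕ) : ℕ :=
  Option.casesOn (Encodable.decode (α := List Bool × ℕ) u) 0 fun q =>
    if q.1.length < m ∧ Nat.Partrec.Code.evaln q.2 C (Encodable.encode q.1) =
      some (Encodable.encode y) then 1 else 0

theorem primrec_hits (C : Nat.Partrec.Code) :
    Primrec fun q : (ℕ × List Bool) × ℕ => hits C q.1.1 q.1.2 q.2 := by
  unfold hits
  refine Primrec.option_casesOn
    (o := fun q : (ℕ × List Bool) × ℕ => Encodable.decode (α := List Bool × ℕ) q.2)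
    (f := fun _ => 0)
    (g := fun q r => if r.1.length < q.1.1 ∧ Nat.Partrec.Code.evaln r.2 C (Encodable.encode r.1) =
      some (Encodable.encode q.1.2) then 1 else 0)
    (Primrec.decode.comp Primrec.snd) (Primrec.const 0) ?_
  refine Primrec.ite (PrimrecPred.and ?_ ?_) (Primrec.const 1) (Primrec.const 0)
  · exact Primrec.nat_lt.comp (Primrec.list_length.comp (Primrec.fst.comp Primrec.snd))
      (Primrec.fst.comp (Primrec.fst.comp Primrec.fst))
  · refine Primrec.eq.comp ?_ (Primrec.option_some.comp (Primrec.encode.comp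
      (Primrec.snd.comp (Primrec.fst.comp Primrec.fst))))
    exact Nat.Partrec.Code.primrec_evaln.comp (Primrec.pair
      (Primrec.pair (Primrec.snd.comp Primrec.snd) (Primrec.const C))
      (Primrec.encode.comp (Primrec.fst.comp Primrec.snd)))

/-- The indicator function of the strings for which a program of length less than `m` is found
in `t` steps. -/
def foundBelow (C : Nat.Partrec.Code) (m t : ℕ) (y : List Bool) : ℕ :=
  min 1 (∑ u ∈ Finset.range t, hits C m y u)

theorem primrec_foundBelow (C : Nat.Partrec.Code) :
    Primrec fun q : (ℕ × ℕ) × List Bool => foundBelow C q.1.1 q.1.2 q.2 := by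
  refine Primrec.nat_min.comp (Primrec.const 1)
    (Primrec.sum_range ?_ (Primrec.snd.comp Primrec.fst))
  exact (primrec_hits C).comp (Primrec.pair
    (Primrec.pair (Primrec.fst.comp (Primrec.fst.comp Primrec.fst))
      (Primrec.snd.comp Primrec.fst)) Primrec.snd)

/-- The code `C` computes the partial function `U` on encoded strings. -/
def IsCodeOf (C : Nat.Partrec.Code) (U : List Bool →. List Bool) : Prop :=
  C.eval = fun n => (Encodable.decode (α := List Bool) n : Part (List Bool)).bind
    fun p => (U p).map Encodable.encode

section Interpreter

variable {U : List Bool →. List Bool} {C : Nat.Partrec.Code}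

theorem IsCodeOf.mem_eval_iff (hC : IsCodeOf C U) (p y : List Bool) :
    Encodable.encode y ∈ C.eval (Encodable.encode p) ↔ y ∈ U p := by
  rw [hC]
  simp

theorem IsCodeOf.plainComplexity_lt_of_foundBelow (hC : IsCodeOf C U) {m t : ℕ} {y : List Bool}
    (h : foundBelow C m t y ≠ 0) : plainComplexity U y < m := by
  have h1 : ∑ u ∈ Finset.range t, hits C m y u ≠ 0 := by
    intro h0
    simp [foundBelow, h0] at h
  obtain ⟨u, -, hu⟩ := Finset.exists_ne_zero_of_sum_ne_zero h1
  unfold hits at hu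
  rcases hd : Encodable.decode (α := List Bool × ℕ) u with _ | ⟨p, k⟩ <;> rw [hd] at hu
  · exact absurd rfl hu
  · have hp : p.length < m ∧ Nat.Partrec.Code.evaln k C (Encodable.encode p) =
        some (Encodable.encode y) := by
      by_contra hp
      exact hu (if_neg hp)
    refine lt_of_le_of_lt (Nat.sInf_le ⟨p, ?_, rfl⟩) hp.1
    exact (hC.mem_eval_iff p y).1 (Nat.Partrec.Code.evaln_sound hp.2)

theorem IsCodeOf.eventually_foundBelow (hC : IsCodeOf C U) (hU : IsOptimalLanguage U) {m : ℕ} {y : List Bool}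
    (h : plainComplexity U y < m) : ∀ᶠ t in atTop, foundBelow C m t y = 1 := by
  obtain ⟨p₀, hp₀⟩ := hU.exists_program y
  obtain ⟨p, hp, hpl⟩ := Nat.sInf_mem
    (s := {k : ℕ | ∃ p : List Bool, y ∈ U p ∧ p.length = k}) ⟨_, p₀, hp₀, rfl⟩
  change p.length = plainComplexity U y at hpl
  obtain ⟨k, hk⟩ := Nat.Partrec.Code.evaln_complete.1 ((hC.mem_eval_iff p y).2 hp)
  filter_upwards [eventually_gt_atTop (Encodable.encode (p, k))] with t ht
  have h1 : hits C m y (Encodable.encode (p, k)) = 1 := by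
    unfold hits
    rw [Encodable.encodek]
    exact if_pos ⟨hpl ▸ h, hk⟩
  have h2 := Finset.single_le_sum (f := hits C m y) (fun _ _ => Nat.zero_le _)
    (Finset.mem_range.2 ht)
  unfold foundBelow
  omega

/-- The weight of the string `y` in the distribution obtained from `x` by the noise that `s`
encodes, up to normalization. -/
def noiseWeight (s n : ℕ) (x y : List Bool) : ℕ :=
  ∏ i ∈ Finset.range n, if x.getD i false = y.getD i false then noiseLevel s i else 1

theorem primrec_noiseWeight :
    Primrec fun q : (ℕ × ℕ) × List Bool × List Bool => noiseWeight q.1.1 q.1.2 q.2.1 q.2.2 := by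
  refine Primrec.prod_range ?_ (Primrec.snd.comp Primrec.fst)
  have hs : Primrec fun q : ((ℕ × ℕ) × List Bool × List Bool) × ℕ => q.1.1.1 :=
    Primrec.fst.comp (Primrec.fst.comp Primrec.fst)
  have hx : Primrec fun q : ((ℕ × ℕ) × List Bool × List Bool) × ℕ => q.1.2.1 :=
    Primrec.fst.comp (Primrec.snd.comp Primrec.fst)
  have hy : Primrec fun q : ((ℕ × ℕ) × List Bool × List Bool) × ℕ => q.1.2.2 :=
    Primrec.snd.comp (Primrec.snd.comp Primrec.fst)
  exact Primrec.ite (Primrec.eq.comp ((Primrec.list_getD false).comp hx Primrec.snd)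
      ((Primrec.list_getD false).comp hy Primrec.snd))
    (primrec_noiseLevel.comp hs Primrec.snd) (Primrec.const 1)

/-- Whether `x` is a string of length `n` that the noise encoded by `s` moves with probability
more than `1 / (n + 1) ^ 2` to a string found in `t` steps to have complexity less than `m`, where
`a` encodes `n`, `m` and `s`. -/
def likelySimple (C : Nat.Partrec.Code) (a : ℕ) (x : List Bool) (t : ℕ) : Bool :=
  decide (x.length = a.unpair.1) &&
    decide (∏ i ∈ Finset.range a.unpair.1, (noiseLevel a.unpair.2.unpair.2 i + 1) <
      (a.unpair.1 + 1) ^ 2 * ∑ j ∈ Finset.range (2 ^ a.unpair.1),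
        foundBelow C a.unpair.2.unpair.1 t (digitString a.unpair.1 j) *
          noiseWeight a.unpair.2.unpair.2 a.unpair.1 x (digitString a.unpair.1 j))

theorem primrec_likelySimple (C : Nat.Partrec.Code) :
    Primrec fun q : ℕ × List Bool × ℕ => likelySimple C q.1 q.2.1 q.2.2 := by
  have hn : Primrec fun a : ℕ => a.unpair.1 := Primrec.fst.comp Primrec.unpair
  have hm : Primrec fun a : ℕ => a.unpair.2.unpair.1 :=
    Primrec.fst.comp (Primrec.unpair.comp (Primrec.snd.comp Primrec.unpair))
  have hs : Primrec fun a : ℕ => a.unpair.2.unpair.2 :=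
    Primrec.snd.comp (Primrec.unpair.comp (Primrec.snd.comp Primrec.unpair))
  have hn' : Primrec fun q : ℕ × List Bool × ℕ => q.1.unpair.1 := hn.comp Primrec.fst
  refine Primrec.and.comp (Primrec.eq.decide.comp
    (Primrec.list_length.comp (Primrec.fst.comp Primrec.snd)) hn') (Primrec.nat_lt.decide.comp ?_ ?_)
  · refine Primrec.prod_range (Primrec.succ.comp ?_) hn'
    exact primrec_noiseLevel.comp (hs.comp (Primrec.fst.comp Primrec.fst)) Primrec.snd
  · refine Primrec.nat_mul.comp ?_ (Primrec.sum_range ?_ (primrec_two_pow.comp hn'))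
    · exact (Primrec.nat_mul.comp (Primrec.succ.comp hn') (Primrec.succ.comp hn')).of_eq
        fun q => (sq _).symm
    · have ha : Primrec fun q : (ℕ × List Bool × ℕ) × ℕ => q.1.1 :=
        Primrec.fst.comp Primrec.fst
      have hy : Primrec fun q : (ℕ × List Bool × ℕ) × ℕ => digitString q.1.1.unpair.1 q.2 :=
        primrec_digitString.comp (hn.comp ha) Primrec.snd
      have ht : Primrec fun q : (ℕ × List Bool × ℕ) × ℕ => q.1.2.2 :=
        Primrec.snd.comp (Primrec.snd.comp Primrec.fst)
      have hx : Primrec fun q : (ℕ × List Bool × ℕ) × ℕ => q.1.2.1 :=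
        Primrec.fst.comp (Primrec.snd.comp Primrec.fst)
      have hf := (primrec_foundBelow C).comp (((hm.comp ha).pair ht).pair hy)
      have hw := primrec_noiseWeight.comp (((hs.comp ha).pair (hn.comp ha)).pair (hx.pair hy))
      exact Primrec.nat_mul.comp hf hw

theorem noiseWeight_ofFn (s n : ℕ) (x y : Fin n → Bool) :
    noiseWeight s n (List.ofFn x) (List.ofFn y) =
      ∏ i, if x i = y i then noiseLevel s i else 1 := by
  rw [noiseWeight, Finset.prod_range]
  refine Finset.prod_congr rfl fun i _ => ?_
  simp [List.getD_eq_getElem?_getD]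

/-- The common denominator `∏ (noiseLevel s i + 1)` of the probabilities is cleared, so the test
compares natural numbers. -/
theorem likelySimple_ofFn {n m s t : ℕ} {x : Fin n → Bool} :
    likelySimple C (Nat.pair n (Nat.pair m s)) (List.ofFn x) t = true ↔
      ∏ i : Fin n, (noiseLevel s i + 1) < (n + 1) ^ 2 * ∑ y : Fin n → Bool,
        foundBelow C m t (List.ofFn y) * ∏ i, if x i = y i then noiseLevel s i else 1 := by
  simp only [likelySimple, Nat.unpair_pair, List.length_ofFn, decide_true, Bool.true_and,
    decide_eq_true_eq, ← noiseWeight_ofFn]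
  rw [sum_digitString n fun y => foundBelow C m t y * noiseWeight s n (List.ofFn x) y,
    Finset.prod_range]

open Classical in
/-- The strings of length `n` and complexity less than `m`. -/
noncomputable def simpleStrings (U : List Bool →. List Bool) (n m : ℕ) :
    Finset (Fin n → Bool) :=
  {y | plainComplexity U (List.ofFn y) < m}

open Classical in
/-- The strings of length `n` that the noise encoded by `s` moves with probability more than
`1 / (n + 1) ^ 2` to a string of complexity less than `m`. -/
noncomputable def nearSimpleStrings (U : List Bool →. List Bool) (n m s : ℕ) :
    Finset (Fin n → Bool) :=
  {x | ∏ i : Fin n, (noiseLevel s i + 1) < (n + 1) ^ 2 * ∑ y ∈ simpleStrings U n m,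
    ∏ i, if x i = y i then noiseLevel s i else 1}

/-- Running short programs for more and more steps approximates the set of simple strings from
below, so near-simple strings can be enumerated from `n`, `m` and `s`. -/
theorem IsOptimalLanguage.exists_complexity_le_of_nearSimple (hU : IsOptimalLanguage U) :
    ∃ c : ℕ, ∀ n m s : ℕ, ∀ x ∈ nearSimpleStrings U n m s,
      plainComplexity U (List.ofFn x) ≤ (nearSimpleStrings U n m s).card.size +
        2 * (Nat.pair n (Nat.pair m s)).size + c := by
  classical
  obtain ⟨C, hC⟩ := Nat.Partrec.Code.exists_code.1 hU.1
  replace hC : IsCodeOf C U := hC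
  obtain ⟨c, hc⟩ := hU.exists_complexity_le_of_enumerable (primrec_likelySimple C)
  refine ⟨c, fun n m s x hx => ?_⟩
  have hsub : ∀ (l : List Bool) (t : ℕ),
      likelySimple C (Nat.pair n (Nat.pair m s)) l t = true →
        l ∈ (nearSimpleStrings U n m s).image List.ofFn := by
    intro l t hl
    have hlen : l.length = n := by
      simp only [likelySimple, Nat.unpair_pair, Bool.and_eq_true, decide_eq_true_eq] at hl
      exact hl.1
    obtain ⟨y, rfl⟩ : ∃ y : Fin n → Bool, List.ofFn y = l := by
      subst hlen
      exact ⟨l.get, List.ofFn_get l⟩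
    have hl' := likelySimple_ofFn.1 hl
    refine Finset.mem_image_of_mem _ ?_
    refine Finset.mem_filter.2 ⟨Finset.mem_univ _, hl'.trans_le (Nat.mul_le_mul_left _ ?_)⟩
    rw [simpleStrings, Finset.sum_filter]
    refine Finset.sum_le_sum fun y _ => ?_
    split_ifs with h
    · exact (Nat.mul_le_mul_right _ (min_le_left _ _)).trans_eq (one_mul _)
    · rw [not_imp_comm.1 hC.plainComplexity_lt_of_foundBelow h, zero_mul]
  -- There are finitely many simple strings, so one stage finds them all.
  have hev : ∀ᶠ t in atTop, ∀ y ∈ simpleStrings U n m, foundBelow C m t (List.ofFn y) = 1 :=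
    (Filter.eventually_all_finset _).2 fun y hy =>
      hC.eventually_foundBelow hU (Finset.mem_filter.1 hy).2
  obtain ⟨t, ht⟩ := hev.exists
  have hxt : likelySimple C (Nat.pair n (Nat.pair m s)) (List.ofFn x) t = true := by
    refine likelySimple_ofFn.2 ((Finset.mem_filter.1 hx).2.trans_le (Nat.mul_le_mul_left _ ?_))
    refine le_trans (Finset.sum_le_sum fun y hy => ?_)
      (Finset.sum_le_sum_of_subset (Finset.subset_univ _))
    rw [ht y hy, one_mul]
  refine (hc _ _ hsub _ _ hxt).trans ?_
  rw [Finset.card_image_of_injective _ List.ofFn_injective]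

end Interpreter

/-! ### Random noise on infinite sequences. -/

theorem sum_flipWeight {k : ℝ} (hk : 0 ≤ k) (a : Bool) : ∑ b, flipWeight k a b = 1 := by
  have : k + 1 ≠ 0 := by linarith
  cases a <;> simp [flipWeight] <;> field_simp
  ring

/-- The distribution of the bit `a` after it is flipped with probability `1 / (k + 1)`. -/
noncomputable def flipLaw (k : ℕ) (a : Bool) : MeasureTheory.Measure Bool :=
  ∑ b, ENNReal.ofReal (flipWeight k a b) • MeasureTheory.Measure.dirac b

theorem flipLaw_singleton (k : ℕ) (a b : Bool) :
    flipLaw k a {b} = ENNReal.ofReal (flipWeight k a b) := by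
  cases b <;> simp [flipLaw]

instance (k : ℕ) (a : Bool) : MeasureTheory.IsProbabilityMeasure (flipLaw k a) := by
  refine ⟨?_⟩
  have h := sum_flipWeight k.cast_nonneg a
  simp only [Fintype.sum_bool] at h
  simp only [flipLaw, Fintype.sum_bool, MeasureTheory.Measure.coe_add, Pi.add_apply,
    MeasureTheory.Measure.smul_apply, MeasureTheory.measure_univ, smul_eq_mul, mul_one]
  rw [← ENNReal.ofReal_add (flipWeight_nonneg k.cast_nonneg _ _)
    (flipWeight_nonneg k.cast_nonneg _ _), h, ENNReal.ofReal_one]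

/-- The distribution of `X` after independent noise that flips the bit at position `i` with
probability `1 / (K i + 1)`. -/
noncomputable def noisyLaw (K : ℕ → ℕ) (X : ℕ → Bool) : MeasureTheory.Measure (ℕ → Bool) :=
  MeasureTheory.Measure.infinitePi fun i => flipLaw (K i) (X i)

instance (K : ℕ → ℕ) (X : ℕ → Bool) : MeasureTheory.IsProbabilityMeasure (noisyLaw K X) := by
  unfold noisyLaw
  infer_instance

theorem noisyLaw_cylinder (K : ℕ → ℕ) (X : ℕ → Bool) {n : ℕ} (y : Fin n → Bool) :
    noisyLaw K X {Y | (fun i : Fin n => Y i) = y} =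
      ENNReal.ofReal (∏ i : Fin n, flipWeight (K i) (X i) (y i)) := by
  have h : {Y : ℕ → Bool | (fun i : Fin n => Y i) = y} =
      Set.pi (Finset.range n : Finset ℕ) fun i => {b | ∀ hi : i < n, b = y ⟨i, hi⟩} := by
    ext Y
    simp only [Set.mem_ofPred_eq, funext_iff, Set.mem_pi, Finset.coe_range, Set.mem_Iio]
    exact ⟨fun h i _ hi' => h ⟨i, hi'⟩, fun h i => h i i.2 i.2⟩
  rw [h, noisyLaw, MeasureTheory.Measure.infinitePi_pi _ fun i _ => MeasurableSet.of_discrete,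
    Finset.prod_range, ENNReal.ofReal_prod_of_nonneg
      fun (i : Fin n) _ => flipWeight_nonneg (K i).cast_nonneg (X i) (y i)]
  refine Finset.prod_congr rfl fun i _ => ?_
  rw [← flipLaw_singleton]
  congr 1
  ext b
  simp

theorem noisyLaw_le (K : ℕ → ℕ) (X : ℕ → Bool) {n : ℕ} (S : Finset (Fin n → Bool)) :
    noisyLaw K X {Y | (fun i : Fin n => Y i) ∈ S} ≤
      ENNReal.ofReal (∑ y ∈ S, ∏ i : Fin n, flipWeight (K i) (X i) (y i)) := by
  have h : {Y : ℕ → Bool | (fun i : Fin n => Y i) ∈ S} =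
      ⋃ y ∈ S, {Y | (fun i : Fin n => Y i) = y} := by
    ext Y
    simp
  rw [h, ENNReal.ofReal_sum_of_nonneg fun y _ => Finset.prod_nonneg fun (i : Fin n) _ =>
    flipWeight_nonneg (K i).cast_nonneg (X i) (y i)]
  refine (MeasureTheory.measure_biUnion_finset_le _ _).trans_eq ?_
  simp only [noisyLaw_cylinder]

/-- The first Borel–Cantelli lemma; the bounds are summable. -/
theorem ae_noisyLaw_eventually_notMem (K : ℕ → ℕ) (X : ℕ → Bool)
    (S : ∀ n, Finset (Fin n → Bool))
    (hS : ∀ᶠ n : ℕ in atTop,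
      ∑ y ∈ S n, ∏ i : Fin n, flipWeight (K i) (X i) (y i) ≤ 1 / ((n : ℝ) + 1) ^ 2) :
    ∀ᵐ Y ∂noisyLaw K X, ∀ᶠ n : ℕ in atTop, (fun i : Fin n => Y i) ∉ S n := by
  obtain ⟨N, hN⟩ := eventually_atTop.1 hS
  have hsum : Summable fun n : ℕ => 1 / ((n : ℝ) + 1) ^ 2 := by
    have := (summable_nat_add_iff 1).2 (Real.summable_one_div_nat_pow.2 one_lt_two)
    simpa using this
  have hle : ∀ n, noisyLaw K X {Y | N ≤ n ∧ (fun i : Fin n => Y i) ∈ S n} ≤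
      ENNReal.ofReal (1 / ((n : ℝ) + 1) ^ 2) := by
    intro n
    by_cases h : N ≤ n
    · refine le_trans (MeasureTheory.measure_mono fun Y hY => hY.2) ((noisyLaw_le K X (S n)).trans ?_)
      exact ENNReal.ofReal_le_ofReal (hN n h)
    · simp [h]
  have hfin : ∑' n, noisyLaw K X {Y | N ≤ n ∧ (fun i : Fin n => Y i) ∈ S n} ≠ ⊤ :=
    ne_top_of_le_ne_top hsum.tsum_ofReal_ne_top (ENNReal.tsum_le_tsum hle)
  filter_upwards [MeasureTheory.ae_eventually_notMem hfin] with Y hY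
  filter_upwards [hY, eventually_ge_atTop N] with n hn hNn hmem
  exact hn ⟨hNn, hmem⟩

/-- A Chernoff bound: the mean of `2 ^ distance` is `∏ (1 + 1 / (k i + 1))`, at most the exponential
of the expected number of flips. -/
theorem sum_prod_flipWeight_far_le (n : ℕ) (k : Fin n → ℝ) (hk : ∀ i, 0 ≤ k i)
    (x : Fin n → Bool) (T : ℝ) :
    ∑ y : Fin n → Bool with T ≤ (hammingDist x y : ℝ), ∏ i, flipWeight (k i) (x i) (y i) ≤
      2 ^ (-T) * Real.exp (∑ i, 1 / (k i + 1)) := by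
  have hw := fun (y : Fin n → Bool) i => flipWeight_nonneg (hk i) (x i) (y i)
  have hpow : ∀ y : Fin n → Bool, (2 : ℝ) ^ (hammingDist x y : ℝ) =
      ∏ i, if x i ≠ y i then (2 : ℝ) else 1 := by
    intro y
    rw [Real.rpow_natCast, Finset.prod_ite]
    simp [hammingDist]
  calc ∑ y : Fin n → Bool with T ≤ (hammingDist x y : ℝ), ∏ i, flipWeight (k i) (x i) (y i)
      ≤ ∑ y : Fin n → Bool with T ≤ (hammingDist x y : ℝ),
          2 ^ (-T) * ∏ i, flipWeight (k i) (x i) (y i) * if x i ≠ y i then (2 : ℝ) else 1 := by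
        refine Finset.sum_le_sum fun y hy => ?_
        rw [Finset.prod_mul_distrib, ← hpow, mul_left_comm, ← Real.rpow_add two_pos]
        refine le_mul_of_one_le_right (Finset.prod_nonneg fun i _ => hw y i)
          (Real.one_le_rpow one_le_two ?_)
        linarith [(Finset.mem_filter.1 hy).2]
    _ ≤ ∑ y : Fin n → Bool,
          2 ^ (-T) * ∏ i, flipWeight (k i) (x i) (y i) * if x i ≠ y i then (2 : ℝ) else 1 := by
        refine Finset.sum_le_sum_of_subset_of_nonneg (Finset.subset_univ _) fun y _ _ => ?_
        refine mul_nonneg (by positivity) (Finset.prod_nonneg fun i _ =>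
          mul_nonneg (hw y i) (by split_ifs <;> norm_num))
    _ = 2 ^ (-T) * ∏ i, (1 / (k i + 1) + 1) := by
        rw [← Finset.mul_sum]
        congr 1
        rw [← Fintype.prod_sum (fun i b => flipWeight (k i) (x i) b * if x i ≠ b then (2 : ℝ) else 1)]
        refine Finset.prod_congr rfl fun i _ => ?_
        have : k i + 1 ≠ 0 := by linarith [hk i]
        cases x i <;> simp [flipWeight] <;> field_simp <;> ring
    _ ≤ 2 ^ (-T) * Real.exp (∑ i, 1 / (k i + 1)) := by
        refine mul_le_mul_of_nonneg_left ?_ (by positivity)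
        rw [Real.exp_sum]
        refine Finset.prod_le_prod (fun i _ => ?_) fun i _ => Real.add_one_le_exp _
        have := hk i
        positivity

theorem add_one_le_two_pow_size (n : ℕ) : (n : ℝ) + 1 ≤ 2 ^ (n.size : ℝ) := by
  rw [Real.rpow_natCast]
  exact_mod_cast Nat.lt_size_self n

theorem tendsto_size_div : Tendsto (fun n : ℕ => (n.size : ℝ) / n) atTop (𝓝 0) := by
  have h1 : Tendsto (fun n : ℕ => Real.log n / n) atTop (𝓝 0) := by
    have := (Real.isLittleO_log_id_atTop.tendsto_div_nhds_zero).comp tendsto_natCast_atTop_atTop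
    exact this
  have h2 : Tendsto (fun n : ℕ => (Real.log n / n) / Real.log 2 + 1 / n) atTop (𝓝 0) := by
    simpa using (h1.div_const (Real.log 2)).add tendsto_one_div_atTop_nhds_zero_nat
  refine squeeze_zero' (Eventually.of_forall fun n => by positivity) ?_ h2
  filter_upwards [eventually_gt_atTop 0] with n hn
  have hn' : (0 : ℝ) < n := by exact_mod_cast hn
  have h3 : 2 ^ (n.size - 1) ≤ n := Nat.lt_size.1 (by have := Nat.size_pos.2 hn; omega)
  have h4 : ((n.size : ℝ) - 1) * Real.log 2 ≤ Real.log n := by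
    have h5 := Real.log_le_log (by positivity) (show ((2 : ℝ) ^ (n.size - 1)) ≤ n by exact_mod_cast h3)
    rwa [Real.log_pow, Nat.cast_sub (Nat.size_pos.2 hn), Nat.cast_one] at h5
  have hl : 0 < Real.log 2 := Real.log_pos one_lt_two
  rw [div_right_comm, ← add_div]
  gcongr
  rw [← sub_le_iff_le_add, le_div_iff₀ hl]
  exact h4

/-- If the flipping probabilities tend to `0`, almost surely so does the fraction of flipped
bits. -/
theorem ae_noisyLaw_tendsto_hammingDist (K : ℕ → ℕ) (hK : Tendsto K atTop atTop)
    (X : ℕ → Bool) :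
    ∀ᵐ Y ∂noisyLaw K X, Tendsto (fun n : ℕ =>
      (hammingDist (fun i : Fin n => X i) (fun i : Fin n => Y i) : ℝ) / n) atTop (𝓝 0) := by
  -- Twice the expected number of flips absorbs the exponential, since `e ≤ 4`; `2 * n.size` leaves
  -- `1 / (n + 1) ^ 2`. By Cesàro, `T n / n` tends to 0.
  let T : ℕ → ℝ := fun n => 2 * ∑ i : Fin n, 1 / ((K i : ℝ) + 1) + 2 * n.size
  have hbound : ∀ n : ℕ, ∑ y : Fin n → Bool with
      T n ≤ (hammingDist (fun i : Fin n => X i) y : ℝ),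
      ∏ i : Fin n, flipWeight (K i) (X i) (y i) ≤ 1 / ((n : ℝ) + 1) ^ 2 := by
    intro n
    refine (sum_prod_flipWeight_far_le n (fun i => K i) (fun i => Nat.cast_nonneg _)
      (fun i => X i) (T n)).trans ?_
    set t := ∑ i : Fin n, 1 / ((K i : ℝ) + 1) with ht
    have ht0 : 0 ≤ t := Finset.sum_nonneg fun i _ => by positivity
    have he : Real.exp t ≤ 2 ^ (2 * t) := by
      rw [← Real.exp_one_rpow, Real.rpow_mul two_pos.le]
      refine Real.rpow_le_rpow (Real.exp_pos 1).le ?_ ht0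
      have := Real.exp_one_lt_d9
      norm_num
      linarith
    calc (2 : ℝ) ^ (-T n) * Real.exp t ≤ 2 ^ (-T n) * 2 ^ (2 * t) := by gcongr
      _ = (2 ^ (n.size : ℝ))⁻¹ ^ 2 := by
        rw [← Real.rpow_add two_pos, ← Real.rpow_neg two_pos.le, ← Real.rpow_two,
          ← Real.rpow_mul two_pos.le]
        congr 1
        simp only [T]
        ring
      _ ≤ ((n : ℝ) + 1)⁻¹ ^ 2 := by
        gcongr
        exact add_one_le_two_pow_size n
      _ = _ := by rw [inv_pow, one_div]
  have hlim : Tendsto (fun n : ℕ => T n / n) atTop (𝓝 0) := by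
    have h1 : Tendsto (fun i : ℕ => 1 / ((K i : ℝ) + 1)) atTop (𝓝 0) :=
      tendsto_one_div_add_atTop_nhds_zero_nat.comp hK
    have h2 := (h1.cesaro.const_mul 2).add (tendsto_size_div.const_mul 2)
    simp only [mul_zero, add_zero] at h2
    refine h2.congr fun n => ?_
    simp only [T]
    rw [Finset.sum_range]
    ring
  filter_upwards [ae_noisyLaw_eventually_notMem K X _ (Eventually.of_forall hbound)] with Y hY
  refine squeeze_zero' (Eventually.of_forall fun n => by positivity) ?_ hlim
  filter_upwards [hY] with n hn
  have : ¬ T n ≤ (hammingDist (fun i : Fin n => X i) (fun i : Fin n => Y i) : ℝ) := by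
    simpa using hn
  exact div_le_div_of_nonneg_right (not_le.1 this).le (Nat.cast_nonneg n)

/-! ### The noise schedule and the complexity gap. -/

/-- Shortest programs of distinct strings are distinct, and fewer than `2 ^ m` programs are shorter
than `m`. -/
theorem card_simpleStrings_le {U : List Bool →. List Bool} (hU : IsOptimalLanguage U) (n m : ℕ) :
    (simpleStrings U n m).card ≤ 2 ^ m := by
  classical
  have h : ∀ y : Fin n → Bool, ∃ p : List Bool,
      List.ofFn y ∈ U p ∧ p.length = plainComplexity U (List.ofFn y) := fun y => by
    obtain ⟨p, hp⟩ := hU.exists_program (List.ofFn y)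
    exact Nat.sInf_mem (s := {k : ℕ | ∃ p : List Bool, List.ofFn y ∈ U p ∧ p.length = k})
      ⟨_, p, hp, rfl⟩
  choose p hp hpl using h
  have hcard : ((Finset.range m).sigma fun l => (Finset.univ : Finset (Fin l → Bool))).card ≤
      2 ^ m := by
    rw [Finset.card_sigma]
    simp only [Finset.card_univ, Fintype.card_pi, Fintype.card_bool, Finset.prod_const,
      Fintype.card_fin]
    exact (Nat.geomSum_lt le_rfl fun k hk => Finset.mem_range.1 hk).le
  refine le_trans (Finset.card_le_card_of_injOn
    (fun y => (⟨(p y).length, (p y).get⟩ : Σ l, Fin l → Bool)) (fun y hy => ?_) ?_) hcard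
  · simpa [hpl] using (Finset.mem_filter.1 hy).2
  · intro y _ z _ hyz
    have h1 := congrArg (fun q : Σ l, Fin l → Bool => List.ofFn q.2) hyz
    simp only [List.ofFn_get] at h1
    exact List.ofFn_injective (Part.mem_unique (hp y) (h1 ▸ hp z))

theorem prod_flipWeight {n : ℕ} (k : Fin n → ℕ) (x y : Fin n → Bool) :
    ∏ i, flipWeight (k i) (x i) (y i) =
      ((∏ i, if x i = y i then k i else 1 : ℕ) : ℝ) / ((∏ i, (k i + 1) : ℕ) : ℝ) := by
  push_cast
  rw [← Finset.prod_div_distrib]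
  rfl

theorem mem_nearSimpleStrings_iff {U : List Bool →. List Bool} {n m s : ℕ} {x : Fin n → Bool} :
    x ∈ nearSimpleStrings U n m s ↔ 1 / ((n : ℝ) + 1) ^ 2 <
      ∑ y ∈ simpleStrings U n m, ∏ i : Fin n, flipWeight (noiseLevel s i) (x i) (y i) := by
  have hpos : (0 : ℝ) < ((∏ i : Fin n, (noiseLevel s i + 1) : ℕ) : ℝ) := by
    exact_mod_cast Finset.prod_pos fun i _ => Nat.succ_pos _
  simp only [prod_flipWeight fun i : Fin n => noiseLevel s i, nearSimpleStrings,
    Finset.mem_filter_univ]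
  rw [← Finset.sum_div, div_lt_div_iff₀ (by positivity) hpos, one_mul, mul_comm]
  exact_mod_cast Iff.rfl

/-- Noise that decreases slowly enough compared with a sequence tending to `0`, and that has short
descriptions. -/
theorem exists_noise_schedule {e : ℕ → ℝ} (he : Tendsto e atTop (𝓝 0)) {κ : ℝ} (hκ : 0 < κ) :
    ∃ K s : ℕ → ℕ, Tendsto K atTop atTop ∧ Monotone K ∧ (∀ i, 1 ≤ K i) ∧
      (∀ n i, i ≤ n → noiseLevel (s n) i = K i) ∧ (∀ n, s n < 2 ^ n.size) ∧
      ∀ᶠ n in atTop, e n ≤ κ / (K n + 1) := by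
  classical
  -- Once `k + 1` thresholds are passed, `K n = k + 2`, hence the denominator `k + 3`.
  have h1 : ∀ k : ℕ, ∀ᶠ j : ℕ in atTop, ∀ n : ℕ, j ≤ n.size → e n ≤ κ / (k + 3) := by
    intro k
    obtain ⟨N, hN⟩ := eventually_atTop.1
      (he.eventually (Iic_mem_nhds (show (0 : ℝ) < κ / (k + 3) by positivity)))
    filter_upwards [eventually_gt_atTop N.size] with j hj n hn
    refine hN n ?_
    by_contra hlt
    have := Nat.size_le_size (not_le.1 hlt).le
    omega
  obtain ⟨φ, hφ, hφe⟩ := extraction_forall_of_eventually h1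
  -- The noise changes only at lengths `2 ^ j` with `j ∈ S`, so up to position `n` it is described
  -- by the `n.size` bits of the indicator of `S`.
  let S : ℕ → Prop := fun j => j ∈ Set.range φ
  have hcount : ∀ k, Nat.count S (φ k) = k := by
    intro k
    have : (Finset.range (φ k)).filter S = (Finset.range k).image φ := by
      ext j
      simp only [Finset.mem_filter, Finset.mem_range, Finset.mem_image, S, Set.mem_range]
      constructor
      · rintro ⟨h, i, rfl⟩
        exact ⟨i, hφ.lt_iff_lt.1 h, rfl⟩
      · rintro ⟨i, h, rfl⟩
        exact ⟨hφ h, i, rfl⟩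
    rw [Nat.count_eq_card_filter_range, this, Finset.card_image_of_injective _ hφ.injective,
      Finset.card_range]
  have hmono : Monotone fun i : ℕ => 1 + Nat.count S i.size := fun i j hij =>
    Nat.add_le_add_left (Nat.count_monotone S (Nat.size_le_size hij)) 1
  have htop : Tendsto (fun i : ℕ => 1 + Nat.count S i.size) atTop atTop := by
    refine tendsto_atTop_atTop_of_monotone hmono fun b => ⟨2 ^ φ b, ?_⟩
    have h2 : φ b ≤ (2 ^ φ b).size := (Nat.lt_size.2 le_rfl).le
    have := Nat.count_monotone S h2
    rw [hcount] at this
    omega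
  refine ⟨fun i => 1 + Nat.count S i.size,
    fun n => finFunctionFinEquiv (m := 2) fun j : Fin n.size => if S j then 1 else 0,
    htop, hmono, fun i => Nat.le_add_right _ _, fun n i hi => ?_, fun n => Fin.is_lt _, ?_⟩
  · have hdigit : ∀ j < n.size, binaryDigit
        (finFunctionFinEquiv (m := 2) fun j : Fin n.size => if S j then 1 else 0) j =
          if S j then 1 else 0 := by
      intro j hj
      have h2 := congrFun (finFunctionFinEquiv (m := 2).symm_apply_apply
        fun j : Fin n.size => if S j then 1 else 0) ⟨j, hj⟩
      have h3 := congrArg Fin.val h2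
      simp only [finFunctionFinEquiv_symm_apply_val] at h3
      rw [binaryDigit, h3]
      split_ifs <;> rfl
    -- The cutoff `j < i` in `noiseLevel` loses nothing, since `2 ^ j ≤ i` implies it.
    have hfilter : (Finset.range i).filter (fun j => 2 ^ j ≤ i) = Finset.range i.size := by
      ext j
      simp only [Finset.mem_filter, Finset.mem_range, ← Nat.lt_size]
      exact ⟨fun h => h.2, fun h => ⟨Nat.lt_two_pow_self.trans_le (Nat.lt_size.1 h), h⟩⟩
    change _ = 1 + Nat.count S i.size
    rw [noiseLevel, ← Finset.sum_filter, hfilter, Nat.count_eq_card_filter_range,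
      Finset.card_filter]
    congr 1
    refine Finset.sum_congr rfl fun j hj => hdigit j ?_
    exact (Finset.mem_range.1 hj).trans_le (Nat.size_le_size hi)
  · filter_upwards [htop.eventually_ge_atTop 2] with n hn
    obtain ⟨k, hk⟩ : ∃ k, Nat.count S n.size = k + 1 := ⟨Nat.count S n.size - 1, by omega⟩
    have hlt : φ k ≤ n.size := by
      by_contra h
      have := Nat.count_monotone S (not_le.1 h).le
      rw [hcount] at this
      omega
    refine (hφe k n hlt).trans_eq ?_
    rw [hk]
    push_cast
    ring

theorem size_le_logb_add_one {n : ℕ} (hn : 0 < n) : (n.size : ℝ) ≤ Real.logb 2 n + 1 := by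
  have h1 : 2 ^ (n.size - 1) ≤ n := Nat.lt_size.1 (by have := Nat.size_pos.2 hn; omega)
  have h2 : ((2 : ℝ) ^ (n.size - 1)) ≤ n := by exact_mod_cast h1
  have h3 := Real.logb_le_logb_of_le one_lt_two (by positivity) h2
  rw [Real.logb_pow, Nat.cast_sub (Nat.size_pos.2 hn), Real.logb_self_eq_one one_lt_two] at h3
  push_cast at h3
  linarith

theorem size_pair_le {a b k : ℕ} (ha : a < 2 ^ k) (hb : b < 2 ^ k) :
    (Nat.pair a b).size ≤ 2 * k := by
  rw [Nat.size_le]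
  refine (Nat.pair_lt_max_add_one_sq a b).trans_le ?_
  rw [mul_comm, pow_mul]
  exact Nat.pow_le_pow_left (max_lt ha hb) 2

/-- If strings of complexity less than `m` are reached from `x` by the noise with a probability
that is not too small, then the complexity of `x` is smaller than `m` by a gap. -/
theorem IsOptimalLanguage.exists_complexity_gap {U : List Bool →. List Bool}
    (hU : IsOptimalLanguage U) :
    ∃ c : ℕ, ∀ (n m s k : ℕ), m ≤ n → s < 2 ^ n.size → (∀ i < n, 1 ≤ noiseLevel s i) →
      (∀ i < n, noiseLevel s i ≤ k) → 1 ≤ k → ∀ x ∈ nearSimpleStrings U n m s,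
        (1 - 1 / ((k : ℝ) + 1)) * (plainComplexity U (List.ofFn x) - (1 + 8 * n.size + c)) ≤
          m - 1 / ((k : ℝ) + 1) * n + 4 * n.size := by
  obtain ⟨c, hc⟩ := hU.exists_complexity_le_of_nearSimple
  refine ⟨c, fun n m s k hm hs hs1 hsk hk x hx => ?_⟩
  have hB : (nearSimpleStrings U n m s).Nonempty := ⟨x, hx⟩
  have hk' : (1 : ℝ) ≤ k := by exact_mod_cast hk
  have hτ : 1 / ((k : ℝ) + 1) ≤ 1 / 2 := by gcongr; linarith
  -- `k` bounds all noise levels, so `1 / (k + 1)` is admissible at every position. The exponent `2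
  -- * n.size` is chosen because `2 ^ (-e) ≤ 1 / (n + 1) ^ 2`.
  have hsse := logb_card_le (s := 1 / ((k : ℝ) + 1)) (by positivity) n
    (fun i => noiseLevel s i) (fun i => by exact_mod_cast hs1 i i.2)
    (fun i => by
      have : (noiseLevel s i : ℝ) ≤ k := by exact_mod_cast hsk i i.2
      gcongr) hτ (simpleStrings U n m) (nearSimpleStrings U n m s) (e := 2 * n.size) (m := m)
    (by positivity)
    (by rw [Real.rpow_natCast]; exact_mod_cast card_simpleStrings_le hU n m) hB
    (fun z hz => by
      refine le_trans ?_ (mem_nearSimpleStrings_iff.1 hz).le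
      rw [Real.rpow_neg two_pos.le, one_div, mul_comm, Real.rpow_mul two_pos.le, Real.rpow_two]
      gcongr
      exact add_one_le_two_pow_size n)
  have hlog := size_le_logb_add_one hB.card_pos
  have hn := Nat.lt_size_self n
  -- Each pairing doubles the length, and the self-delimiting code doubles it again, which gives `8
  -- * n.size`.
  have hadv : (Nat.pair n (Nat.pair m s)).size ≤ 4 * n.size := by
    have h1 := Nat.size_le.1 (size_pair_le (hm.trans_lt hn) hs)
    have h2 : n < 2 ^ (2 * n.size) := hn.trans_le (Nat.pow_le_pow_right two_pos (by omega))
    have := size_pair_le h2 h1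
    omega
  have hC : (plainComplexity U (List.ofFn x) : ℝ) ≤ ((nearSimpleStrings U n m s).card.size : ℝ) +
      2 * ((Nat.pair n (Nat.pair m s)).size : ℝ) + c := by exact_mod_cast hc n m s x hx
  have hadv' : ((Nat.pair n (Nat.pair m s)).size : ℝ) ≤ 4 * n.size := by exact_mod_cast hadv
  have := mul_le_mul_of_nonneg_left
    (show (plainComplexity U (List.ofFn x) : ℝ) - (1 + 8 * n.size + c) ≤
      Real.logb 2 (nearSimpleStrings U n m s).card by linarith)
    (show 0 ≤ 1 - 1 / ((k : ℝ) + 1) by linarith)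
  linarith

/-- Only the shortfall is kept, because the ratio may stay above `γ` while the schedule needs a
sequence tending to 0. Complexity is nonnegative, so `γ` may be raised to `max γ 0`. -/
theorem tendsto_complexity_defect {U : List Bool →. List Bool} {X : ℕ → Bool} {γ : ℝ}
    (hX : (γ : EReal) ≤ effectiveDim U X) :
    Tendsto (fun n : ℕ => max 0 (max γ 0 - (plainComplexity U (bitPrefix X n) : ℝ) / n))
      atTop (𝓝 0) := by
  rw [Metric.tendsto_nhds]
  intro ε hε
  have hlt : ((γ - ε : ℝ) : EReal) < effectiveDim U X :=
    lt_of_lt_of_le (EReal.coe_lt_coe_iff.2 (by linarith)) hX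
  filter_upwards [eventually_lt_of_lt_liminf hlt] with n hn
  have hn' := EReal.coe_lt_coe_iff.1 hn
  have h0 : (0 : ℝ) ≤ (plainComplexity U (bitPrefix X n) : ℝ) / n := by positivity
  rw [Real.dist_eq, sub_zero, abs_of_nonneg (le_max_left _ _), max_lt_iff, sub_lt_iff_lt_add,
    max_lt_iff]
  exact ⟨hε, by linarith, by linarith⟩

/-! ### The main theorem. -/

theorem theorem4 (U : List Bool →. List Bool) (hU : IsOptimalLanguage U)
    (X : ℕ → Bool) (γ : ℝ) (hγ : γ < 1) (hX : (γ : EReal) ≤ effectiveDim U X)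
    (δ : ℕ → ℝ) (hδ_pos : ∀ n : ℕ, 1 ≤ n → 0 < δ n) (hδ_lim : Tendsto δ atTop (𝓝 0)) :
    ∃ X' : ℕ → Bool,
      besicovitchDist X X' = 0 ∧
      ∀ᶠ n : ℕ in atTop,
        (n : ℝ) * (γ + δ n) ≤ (plainComplexity U (bitPrefix X' n) : ℝ) := by
  obtain ⟨c, hc⟩ := hU.exists_complexity_gap
  set γ' := max γ 0 with hγ'
  have hγ0 : 0 ≤ γ' := le_max_right _ _
  have hκ : 0 < 1 - γ' := sub_pos.2 (max_lt hγ one_pos)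
  set η : ℕ → ℝ := fun n => max 0 (γ' - (plainComplexity U (bitPrefix X n) : ℝ) / n) with hη
  have hηlim : Tendsto η atTop (𝓝 0) := tendsto_complexity_defect hX
  have hinv := tendsto_one_div_atTop_nhds_zero_nat (𝕜 := ℝ)
  -- All the errors, divided by `n`: 12 collects `8 * n.size` and `4 * n.size` from the gap, and `c
  -- + 3` covers its constant `c + 1`, the rounding of `m` and a spare 1.
  have he : Tendsto (fun n : ℕ => η n + δ n + (12 * ((n.size : ℝ) / n) + (c + 3) * (1 / n)))
      atTop (𝓝 0) := by
    simpa using (hηlim.add hδ_lim).add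
      ((tendsto_size_div.const_mul 12).add (hinv.const_mul ((c : ℝ) + 3)))
  obtain ⟨K, s, hKtop, hKmono, hK1, hsK, hs, heK⟩ := exists_noise_schedule he hκ
  let m : ℕ → ℕ := fun n => ⌈(n : ℝ) * (γ' + δ n)⌉₊
  have hmle : ∀ᶠ n : ℕ in atTop, m n ≤ n := by
    have h1 : Tendsto (fun n : ℕ => γ' + δ n) atTop (𝓝 γ') := by
      simpa using hδ_lim.const_add γ'
    filter_upwards [h1.eventually (Iic_mem_nhds (sub_pos.1 hκ))] with n hn
    exact Nat.ceil_le.2 (mul_le_of_le_one_right (Nat.cast_nonneg n) hn)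
  have hbound : ∀ᶠ n : ℕ in atTop, ∑ y ∈ simpleStrings U n (m n),
      ∏ i : Fin n, flipWeight (K i) (X i) (y i) ≤ 1 / ((n : ℝ) + 1) ^ 2 := by
    filter_upwards [hmle, heK, eventually_ge_atTop 1] with n hmn hen hn
    by_contra hlt
    have hmem : (fun i : Fin n => X i) ∈ nearSimpleStrings U n (m n) (s n) := by
      rw [mem_nearSimpleStrings_iff]
      simpa only [hsK n _ (Fin.is_lt _).le, not_le] using hlt
    have hgap := hc n (m n) (s n) (K n) hmn (hs n) (fun i hi => by rw [hsK n i hi.le]; exact hK1 i)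
      (fun i hi => by rw [hsK n i hi.le]; exact hKmono hi.le) (hK1 n) _ hmem
    change _ * ((plainComplexity U (bitPrefix X n) : ℝ) - _) ≤ _ at hgap
    have hn0 : (0 : ℝ) < n := by exact_mod_cast hn
    have hm : (m n : ℝ) < n * (γ' + δ n) + 1 :=
      Nat.ceil_lt_add_one (mul_nonneg hn0.le (add_nonneg hγ0 (hδ_pos n hn).le))
    have hη1 : n * γ' - n * η n ≤ (plainComplexity U (bitPrefix X n) : ℝ) := by
      have h1 : γ' - (plainComplexity U (bitPrefix X n) : ℝ) / n ≤ η n := le_max_right _ _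
      have h2 := mul_le_mul_of_nonneg_left h1 hn0.le
      rw [mul_sub, mul_div_cancel₀ _ hn0.ne'] at h2
      linarith
    have hη0 : 0 ≤ η n := le_max_left _ _
    have hen' := mul_le_mul_of_nonneg_left hen hn0.le
    rw [show (n : ℝ) * (η n + δ n + (12 * ((n.size : ℝ) / n) + (c + 3) * (1 / n))) =
        n * η n + n * δ n + 12 * n.size + (c + 3) by field_simp; ring,
      div_eq_mul_one_div (1 - γ')] at hen'
    set τ := 1 / ((K n : ℝ) + 1) with hτ
    have hτ0 : 0 ≤ τ := by positivity
    have hτ1 : τ ≤ 1 := by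
      rw [hτ, div_le_one (by positivity)]
      linarith [(K n).cast_nonneg (α := ℝ)]
    -- With the nonnegative terms `h2` and `h3` dropped, the gap gives `n τ (1 - γ') < n η + n δ +
    -- 12 * n.size + c + 2`, against the choice of `K`.
    have h1 := mul_le_mul_of_nonneg_left
      (sub_le_sub_right hη1 (1 + 8 * (n.size : ℝ) + c)) (sub_nonneg.2 hτ1)
    have h2 : 0 ≤ τ * (n * η n) := by positivity
    have h3 : 0 ≤ τ * (1 + 8 * (n.size : ℝ) + c) := by positivity
    linarith
  -- Both properties hold almost surely under a probability measure, so some sequence has both.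
  obtain ⟨Y, hYdist, hY⟩ := ((ae_noisyLaw_tendsto_hammingDist K hKtop X).and
    (ae_noisyLaw_eventually_notMem K X _ hbound)).exists
  refine ⟨Y, hYdist.limsup_eq, ?_⟩
  filter_upwards [hY] with n hn
  have hm : m n ≤ plainComplexity U (bitPrefix Y n) := by
    by_contra h
    exact hn (Finset.mem_filter.2 ⟨Finset.mem_univ _, not_le.1 h⟩)
  calc (n : ℝ) * (γ + δ n) ≤ n * (γ' + δ n) := by
        gcongr
        exact le_max_left _ _
    _ ≤ m n := Nat.le_ceil _
    _ ≤ _ := by exact_mod_cast hm
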